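/- All graphs are finite, simple and undirected. For a graph $G$, let $\overline{G}$ denote its complement and let $\eta(G)$ denote the number of nonempty connected induced subgraphs of $G$, i.e. the number of nonempty vertex sets $S\subseteq V(G)$ such that the subgraph of $G$ induced by $S$ is connected. A pendent vertex of a graph is a vertex of degree $1$; a cut vertex is a vertex whose deletion increases the number of connected components. Theorem. Let $G$ be a graph of order $n>4$ such that $\eta(H)+\eta(\overline{H})\le \eta(G)+\eta(\overline{G})$ for all graphs $H$ of order $n$. Then: 1) $G$ and $\overline{G}$ are both connected. 2) Each of $G$ and $\overline{G}$ has diameter $2$ or $3$. 3) Neither $G$ nor $\overline{G}$ has a pendent vertex, and neither $G$ nor $\overline{G}$ has a cut vertex. -/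

import Mathlib

namespace SimpleGraph

variable {V : Type*}

/-- `η(G)`: the number of nonempty connected induced subgraphs of `G`. An induced subgraph is
determined by its vertex set `S`, and `SimpleGraph.Connected` includes that `S` is nonempty. -/
noncomputable def numConnectedInduced (G : SimpleGraph V) : ℕ :=
  {S : Set V | (G.induce S).Connected}.ncard

/-- A pendent vertex: a vertex of degree one. -/
def IsPendentVertex (G : SimpleGraph V) (v : V) : Prop :=
  (G.neighborSet v).ncard = 1

/-- A cut vertex: a vertex whose deletion increases the number of connected components
(used for graphs on finite vertex sets). -/
def IsCutVertex (G : SimpleGraph V) (v : V) : Prop :=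
  Nat.card G.ConnectedComponent < Nat.card (G.induce {v}ᶜ).ConnectedComponent

end SimpleGraph

/-!
Every nonempty vertex set is connected in `G` or in `Gᶜ`, so `η(G) + η(Gᶜ)` is `2 ^ n - 1` plus the
number of *biconnected* sets, those connected in both. Hence `G` and `Gᶜ` maximise the number of
biconnected sets (`IsBiconnMax`), and each property is proved by comparing `G` with another graph
that would have more of them.

* Pendent vertices (`IsBiconnMax.not_pendent`). Let `w` be pendent at `x`. Making `w` adjacent
  exactly to the nonneighbours of `x` instead keeps every biconnected set. It creates a new one if
  some biconnected set without `x` and `w` has both neighbours and nonneighbours of `x`, so in a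
  maximiser there are no such sets. Then only about half of all vertex sets can be biconnected:
  for `a` neighbours and `b` nonneighbours of `x` other than `w` there are at most
  `2 * 2 ^ (a + b) - (2 ^ a - 1) - (2 ^ b - 1) - (a + b).choose 2` of them. Blow-ups of the
  five-cycle do better, because every set that misses at most one of the five classes is
  biconnected in them (`two_mul_two_pow_lt_card_biconnectedSets`).
* An isolated vertex could be joined to any other vertex without loss, so it is excluded as well
  (`IsBiconnMax.exists_adj`).
* Connectedness and diameter (`IsBiconnMax.exists_short_walk`). If no walk of length at most three
  joins `u` and `v`, adding the edge `uv` keeps every biconnected set and creates a new induced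
  path `a - u - v - b`. That the diameter is at least two holds because `Gᶜ` has an edge.
* Cut vertices (`IsBiconnMax.not_separated`). If `x` separates `U` from `W`, the bound on distances
  forces `x` to be adjacent to all of one side, say `W`. Choose `u ∈ U` not adjacent to `x`. If some
  `w ∈ W` has two neighbours in `W`, adding the edge `uw` creates more biconnected sets than it
  destroys. Otherwise the components of `W` have one or two vertices; deleting the edge of a
  component with two vertices costs nothing, and in either case a pendent vertex results.
-/

namespace SimpleGraph

section

/-! ### Connected induced subgraphs and biconnected sets -/

variable {V : Type*}

/-- `b` can be reached from `a` by a walk of `G` that stays inside `S`. -/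
def ReachIn (G : SimpleGraph V) (S : Set V) (a b : V) : Prop :=
  ∃ (ha : a ∈ S) (hb : b ∈ S), (G.induce S).Reachable ⟨a, ha⟩ ⟨b, hb⟩

namespace ReachIn

variable {G : SimpleGraph V} {S : Set V} {a b c d : V}

theorem refl (ha : a ∈ S) : G.ReachIn S a a := ⟨ha, ha, Reachable.refl _⟩

theorem symm (h : G.ReachIn S a b) : G.ReachIn S b a := by
  obtain ⟨ha, hb, h⟩ := h
  exact ⟨hb, ha, h.symm⟩

theorem trans (h : G.ReachIn S a b) (h' : G.ReachIn S b c) : G.ReachIn S a c := by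
  obtain ⟨ha, _, h⟩ := h
  obtain ⟨_, hc, h'⟩ := h'
  exact ⟨ha, hc, h.trans h'⟩

theorem of_adj (h : G.Adj a b) (ha : a ∈ S) (hb : b ∈ S) : G.ReachIn S a b :=
  ⟨ha, hb, Adj.reachable (by simpa using h)⟩

theorem of_adj₂ (h : G.Adj a b) (h' : G.Adj b c) (ha : a ∈ S) (hb : b ∈ S) (hc : c ∈ S) :
    G.ReachIn S a c :=
  (of_adj h ha hb).trans (of_adj h' hb hc)

theorem of_adj₃ (h : G.Adj a b) (h' : G.Adj b c) (h'' : G.Adj c d) (ha : a ∈ S) (hb : b ∈ S)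
    (hc : c ∈ S) (hd : d ∈ S) : G.ReachIn S a d :=
  (of_adj₂ h h' ha hb hc).trans (of_adj h'' hc hd)

end ReachIn

theorem connected_induce_of_reachIn {G : SimpleGraph V} {S : Set V} {r : V} (hr : r ∈ S)
    (h : ∀ z ∈ S, G.ReachIn S z r) : (G.induce S).Connected := by
  rw [connected_iff_exists_forall_reachable]
  refine ⟨⟨r, hr⟩, fun z => ?_⟩
  obtain ⟨_, _, hz⟩ := h z z.2
  exact hz.symm

theorem Connected.reachIn {G : SimpleGraph V} {S : Set V} (h : (G.induce S).Connected) {a b : V}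
    (ha : a ∈ S) (hb : b ∈ S) : G.ReachIn S a b :=
  ⟨ha, hb, h.preconnected _ _⟩

/-- A walk of `G` inside `S` can be followed, up to the map `f`, inside `T` by walks of `H`, as
soon as each of its edges can. -/
theorem ReachIn.map {G H : SimpleGraph V} {S T : Set V} (f : V → V) (hf : ∀ a ∈ S, f a ∈ T)
    (h : ∀ a ∈ S, ∀ b ∈ S, G.Adj a b → H.ReachIn T (f a) (f b)) {a b : V}
    (hab : G.ReachIn S a b) : H.ReachIn T (f a) (f b) := by
  obtain ⟨ha, hb, ⟨p⟩⟩ := hab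
  have key : ∀ (u v : S), (G.induce S).Walk u v → H.ReachIn T (f u) (f v) := by
    intro u v p
    induction p with
    | nil => exact .refl (hf _ (Subtype.coe_prop _))
    | cons hadj _ ih => exact (h _ (Subtype.coe_prop _) _ (Subtype.coe_prop _) hadj).trans ih
  exact key _ _ p

/-- Connectedness of an induced subgraph survives a change of the graph if the ends of each edge
are still joined by a walk. -/
theorem Connected.transfer {G H : SimpleGraph V} {S : Set V} (hS : (G.induce S).Connected)
    (h : ∀ a ∈ S, ∀ b ∈ S, G.Adj a b → H.ReachIn S a b) : (H.induce S).Connected := by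
  obtain ⟨r⟩ := hS.nonempty
  exact connected_induce_of_reachIn r.2 fun z hz =>
    ReachIn.map id (fun _ ha => ha) h (hS.reachIn hz r.2)

/-- A set closed under adjacency inside `S` that meets `S` contains `S`. -/
theorem Connected.subset_of_closed {G : SimpleGraph V} {S : Set V} (hS : (G.induce S).Connected)
    {C : Set V} {a : V} (haS : a ∈ S) (haC : a ∈ C)
    (h : ∀ u ∈ S, ∀ v ∈ S, G.Adj u v → u ∈ C → v ∈ C) : S ⊆ C := by
  intro b hb
  obtain ⟨_, _, ⟨p⟩⟩ := hS.reachIn haS hb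
  have key : ∀ (u v : S), (G.induce S).Walk u v → (u : V) ∈ C → (v : V) ∈ C := by
    intro u v p
    induction p with
    | nil => exact id
    | cons hadj _ ih =>
      exact fun hu => ih (h _ (Subtype.coe_prop _) _ (Subtype.coe_prop _) hadj hu)
  exact key _ _ p haC

theorem Connected.exists_adj_of_ne {G : SimpleGraph V} {S : Set V} (hS : (G.induce S).Connected)
    {a b : V} (ha : a ∈ S) (hb : b ∈ S) (hab : a ≠ b) : ∃ z ∈ S, G.Adj a z := by
  by_contra! hno
  have := hS.subset_of_closed (C := {a}) ha rfl
    (fun u _ v hv huv hu => absurd (hu ▸ huv) (hno v hv))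
  exact hab (this hb).symm

theorem connected_induce_or_compl (G : SimpleGraph V) {S : Set V} (hS : S.Nonempty) :
    (G.induce S).Connected ∨ (Gᶜ.induce S).Connected := by
  have := hS.to_subtype
  rcases (G.induce S).connected_or_connected_compl with h | h
  · exact .inl h
  · right
    convert h using 1
    ext a b
    simp [Subtype.ext_iff]

open Classical in
/-- The vertex sets `S` for which both `G` and its complement induce a connected subgraph. -/
noncomputable def biconnectedSets [Fintype V] (G : SimpleGraph V) : Finset (Finset V) :=
  {S | (G.induce (S : Set V)).Connected ∧ (Gᶜ.induce (S : Set V)).Connected}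

section Count

variable [Fintype V]

theorem mem_biconnectedSets {G : SimpleGraph V} {S : Finset V} :
    S ∈ G.biconnectedSets ↔
      (G.induce (S : Set V)).Connected ∧ (Gᶜ.induce (S : Set V)).Connected := by
  simp [biconnectedSets]

theorem biconnectedSets_compl (G : SimpleGraph V) :
    Gᶜ.biconnectedSets = G.biconnectedSets := by
  ext S
  rw [mem_biconnectedSets, mem_biconnectedSets, compl_compl, and_comm]

theorem singleton_mem_biconnectedSets (G : SimpleGraph V) (v : V) :
    {v} ∈ G.biconnectedSets := by
  rw [mem_biconnectedSets]
  constructor <;>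
  · refine connected_induce_of_reachIn (r := v) (by simp) fun z hz => ?_
    obtain rfl : z = v := by simpa using hz
    exact .refl hz

/-- Every nonempty vertex set is connected in `G` or in its complement, so `η(G) + η(Gᶜ)` counts
all of them once and the biconnected ones twice. -/
theorem numConnectedInduced_add_compl (G : SimpleGraph V) :
    G.numConnectedInduced + Gᶜ.numConnectedInduced =
      (2 ^ Fintype.card V - 1) + G.biconnectedSets.card := by
  classical
  rw [numConnectedInduced, numConnectedInduced, ← Set.ncard_union_add_ncard_inter]
  congr 1
  · have : {S : Set V | (G.induce S).Connected} ∪ {S : Set V | (Gᶜ.induce S).Connected} =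
        {∅}ᶜ := by
      ext S
      simp only [Set.mem_union, Set.mem_ofPred_eq, Set.mem_compl_iff, Set.mem_singleton_iff]
      constructor
      · rintro (h | h) rfl <;> exact (h.nonempty.some).2
      · exact fun h => G.connected_induce_or_compl (Set.nonempty_iff_ne_empty.2 h)
    rw [this, Set.ncard_compl, Set.ncard_singleton, Nat.card_eq_fintype_card, Fintype.card_set]
  · have : {S : Set V | (G.induce S).Connected} ∩ {S : Set V | (Gᶜ.induce S).Connected} =
        (fun S : Finset V => (S : Set V)) '' (G.biconnectedSets : Set (Finset V)) := by
      ext S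
      simp only [Set.mem_inter_iff, Set.mem_ofPred_eq, Set.mem_image, Finset.mem_coe,
        mem_biconnectedSets]
      constructor
      · obtain ⟨T, rfl⟩ : ∃ T : Finset V, (T : Set V) = S := ⟨S.toFinset, S.coe_toFinset⟩
        exact fun h => ⟨T, h, rfl⟩
      · rintro ⟨T, hT, rfl⟩
        exact hT
    rw [this, Set.ncard_image_of_injective _ Finset.coe_injective, Set.ncard_coe_finset]

/-- `G` maximises the number of biconnected vertex sets, equivalently `η(G) + η(Gᶜ)`, among the
graphs on its vertex set. -/
def IsBiconnMax (G : SimpleGraph V) : Prop :=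
  ∀ H : SimpleGraph V, H.biconnectedSets.card ≤ G.biconnectedSets.card

theorem IsBiconnMax.compl {G : SimpleGraph V} (hG : G.IsBiconnMax) : Gᶜ.IsBiconnMax := by
  intro H
  rw [biconnectedSets_compl]
  exact hG H

theorem IsBiconnMax.eq_of_subset {G H : SimpleGraph V} (hG : G.IsBiconnMax)
    (h : G.biconnectedSets ⊆ H.biconnectedSets) : G.biconnectedSets = H.biconnectedSets :=
  Finset.eq_of_subset_of_card_le h (hG H)

theorem IsBiconnMax.of_subset {G H : SimpleGraph V} (hG : G.IsBiconnMax)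
    (h : G.biconnectedSets ⊆ H.biconnectedSets) : H.IsBiconnMax :=
  fun K => (hG K).trans (Finset.card_le_card h)

end Count

end

section

variable {V : Type*}

/-! ### Blow-ups of the five-cycle -/

/-- Adjacency in the five-cycle on `Fin 5`, for `b = true`, and in its complement, which is again a
five-cycle, for `b = false`. -/
def pentagonRel (b : Bool) (i j : Fin 5) : Prop :=
  if b then j = i + 1 ∨ i = j + 1 else j = i + 2 ∨ i = j + 2

instance (b : Bool) : DecidableRel (pentagonRel b) := fun i j => by
  unfold pentagonRel; infer_instance

/-- The blow-up of the five-cycle in which the vertices of colour `i` replace the vertex `i` by an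
independent set. -/
def pentagonBlowUp (c : V → Fin 5) : SimpleGraph V where
  Adj u v := pentagonRel true (c u) (c v)
  symm := ⟨fun u v => by unfold pentagonRel; simp only [if_true]; exact Or.symm⟩
  loopless := ⟨fun u => by generalize c u = i; revert i; decide⟩

theorem pentagonBlowUp_compl_adj {c : V → Fin 5} {u v : V} (h : pentagonRel false (c u) (c v)) :
    (pentagonBlowUp c)ᶜ.Adj u v := by
  rw [compl_adj]
  have key : ∀ i j : Fin 5, pentagonRel false i j → i ≠ j ∧ ¬ pentagonRel true i j := by decide
  exact ⟨fun huv => (key _ _ h).1 (congrArg c huv), (key _ _ h).2⟩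

/-- Four vertices of the five-cycle induce a path, in which any two vertices, equal or not, are
joined by a walk of length at most three. -/
theorem exists_pentagonRel_walk (b : Bool) (Q : Finset (Fin 5)) (hQ : 4 ≤ Q.card) :
    ∀ i ∈ Q, ∀ j ∈ Q, pentagonRel b i j ∨ (∃ k ∈ Q, pentagonRel b i k ∧ pentagonRel b k j) ∨
      ∃ k ∈ Q, ∃ l ∈ Q, pentagonRel b i k ∧ pentagonRel b k l ∧ pentagonRel b l j := by
  revert b Q
  decide

theorem connected_induce_of_pentagonRel {G : SimpleGraph V} {c : V → Fin 5} {b : Bool}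
    (hG : ∀ u v, pentagonRel b (c u) (c v) → G.Adj u v) {S : Finset V}
    (hS : 4 ≤ (S.image c).card) : (G.induce (S : Set V)).Connected := by
  obtain ⟨r, hr⟩ : S.Nonempty := by
    rw [Finset.nonempty_iff_ne_empty]
    rintro rfl
    simp at hS
  refine connected_induce_of_reachIn (r := r) hr fun z hz => ?_
  rcases exists_pentagonRel_walk b _ hS (c z) (Finset.mem_image_of_mem c hz) (c r)
    (Finset.mem_image_of_mem c hr) with h | ⟨k, hk, h₁, h₂⟩ | ⟨k, hk, l, hl, h₁, h₂, h₃⟩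
  · exact .of_adj (hG _ _ h) hz hr
  · obtain ⟨y, hy, rfl⟩ := Finset.mem_image.1 hk
    exact .of_adj₂ (hG _ _ h₁) (hG _ _ h₂) hz hy hr
  · obtain ⟨y, hy, rfl⟩ := Finset.mem_image.1 hk
    obtain ⟨y', hy', rfl⟩ := Finset.mem_image.1 hl
    exact .of_adj₃ (hG _ _ h₁) (hG _ _ h₂) (hG _ _ h₃) hz hy hy' hr

theorem mem_biconnectedSets_pentagonBlowUp [Fintype V] {c : V → Fin 5} {S : Finset V}
    (hS : 4 ≤ (S.image c).card) : S ∈ (pentagonBlowUp c).biconnectedSets :=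
  mem_biconnectedSets.2 ⟨connected_induce_of_pentagonRel (b := true) (fun _ _ h => h) hS,
    connected_induce_of_pentagonRel (b := false) (fun _ _ h => pentagonBlowUp_compl_adj h) hS⟩

/-- Biconnected sets of a blow-up of the five-cycle with `k` vertices of colour `0` and the other
vertices coloured by `c`. A set `Q` of other vertices that misses at most one colour other than `0`
is biconnected together with any nonempty set of vertices of colour `0`, and a `Q` that misses none
of them is so by itself. -/
theorem exists_le_card_biconnectedSets [Fintype V] {k r : ℕ} (hV : Fintype.card V = k + r)
    (c : Fin r → Fin 5) (hc : ∀ i, c i ≠ 0) :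
    ∃ H : SimpleGraph V,
      (2 ^ k - 1) * (Finset.univ.filter fun Q : Finset (Fin r) => 3 ≤ (Q.image c).card).card +
        (Finset.univ.filter fun Q : Finset (Fin r) => 4 ≤ (Q.image c).card).card +
          Fintype.card V ≤ H.biconnectedSets.card := by
  classical
  have e : V ≃ Fin k ⊕ Fin r := Fintype.equivOfCardEq (by simp [hV])
  set col : V → Fin 5 := fun v => Sum.elim (fun _ => 0) c (e v) with hcol
  set F₃ := Finset.univ.filter fun Q : Finset (Fin r) => 3 ≤ (Q.image c).card with hF₃
  set F₄ := Finset.univ.filter fun Q : Finset (Fin r) => 4 ≤ (Q.image c).card with hF₄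
  set A : Finset (Finset (Fin k) × Finset (Fin r)) :=
    (Finset.univ.erase ∅ ×ˢ F₃) ∪ ({∅} ×ˢ F₄) with hA
  set g : Finset (Fin k) × Finset (Fin r) → Finset V :=
    fun p => (p.1.disjSum p.2).map e.symm.toEmbedding with hg
  have hg_inj : Function.Injective g := by
    rintro ⟨K, Q⟩ ⟨K', Q'⟩ h
    have h' := Finset.map_injective _ h
    have h₁ : K = K' := by
      ext i
      simpa using congrArg (Sum.inl i ∈ ·) h'
    have h₂ : Q = Q' := by
      ext i
      simpa using congrArg (Sum.inr i ∈ ·) h'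
    rw [h₁, h₂]
  have hA_card : A.card = (2 ^ k - 1) * F₃.card + F₄.card := by
    rw [hA, Finset.card_union_of_disjoint, Finset.card_product, Finset.card_product,
      Finset.card_erase_of_mem (Finset.mem_univ _)]
    · simp
    · rw [Finset.disjoint_left]
      rintro ⟨K, Q⟩ h h'
      simp only [Finset.mem_product, Finset.mem_erase, Finset.mem_singleton] at h h'
      exact h.1.1 h'.1
  have hsub : ∀ p : Finset (Fin k) × Finset (Fin r), p.2.image c ⊆ (g p).image col := by
    rintro ⟨K, Q⟩ i hi
    obtain ⟨q, hq, rfl⟩ := Finset.mem_image.1 hi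
    refine Finset.mem_image.2 ⟨e.symm (Sum.inr q), ?_, by simp [hcol]⟩
    simpa [hg] using hq
  have hA_col : ∀ p ∈ A, 4 ≤ ((g p).image col).card := by
    rintro ⟨K, Q⟩ hp
    rcases Finset.mem_union.1 hp with hp | hp
    · simp only [hF₃, Finset.mem_product, Finset.mem_erase, Finset.mem_filter] at hp
      obtain ⟨i, hi⟩ := Finset.nonempty_iff_ne_empty.2 hp.1.1
      have h0 : (0 : Fin 5) ∈ (g (K, Q)).image col :=
        Finset.mem_image.2 ⟨e.symm (Sum.inl i), by simpa [hg] using hi, by simp [hcol]⟩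
      have h0' : (0 : Fin 5) ∉ Q.image c := by
        simp only [Finset.mem_image, not_exists, not_and]
        exact fun q _ => hc q
      have := Finset.card_le_card (Finset.insert_subset h0 (hsub (K, Q)))
      rw [Finset.card_insert_of_notMem h0'] at this
      have := hp.2.2
      omega
    · simp only [hF₄, Finset.mem_product, Finset.mem_filter] at hp
      exact hp.2.2.trans (Finset.card_le_card (hsub (K, Q)))
  have hdisj : Disjoint (A.image g) (Finset.univ.image fun v : V => ({v} : Finset V)) := by
    rw [Finset.disjoint_left]
    rintro S h h'
    obtain ⟨p, hp, rfl⟩ := Finset.mem_image.1 h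
    obtain ⟨v, -, hv⟩ := Finset.mem_image.1 h'
    have := hA_col p hp
    rw [← hv] at this
    simp at this
  refine ⟨pentagonBlowUp col, ?_⟩
  calc _ = (A.image g ∪ Finset.univ.image fun v : V => ({v} : Finset V)).card := by
        rw [Finset.card_union_of_disjoint hdisj, Finset.card_image_of_injective _ hg_inj,
          Finset.card_image_of_injective _ Finset.singleton_injective, hA_card, Finset.card_univ]
    _ ≤ _ := by
        refine Finset.card_le_card (Finset.union_subset ?_ ?_)
        · intro S hS
          obtain ⟨p, hp, rfl⟩ := Finset.mem_image.1 hS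
          exact mem_biconnectedSets_pentagonBlowUp (hA_col p hp)
        · intro S hS
          obtain ⟨v, -, rfl⟩ := Finset.mem_image.1 hS
          exact singleton_mem_biconnectedSets _ v

/-- Five and six vertices: the class of colour `0` has one or two vertices, the other classes are
single vertices. -/
theorem exists_le_card_biconnectedSets_of_card_eq_add_four [Fintype V] {k : ℕ}
    (hV : Fintype.card V = k + 4) :
    ∃ H : SimpleGraph V, (2 ^ k - 1) * 5 + 1 + (k + 4) ≤ H.biconnectedSets.card := by
  obtain ⟨H, hH⟩ := exists_le_card_biconnectedSets hV ![1, 2, 3, 4] (by decide)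
  refine ⟨H, le_trans (le_of_eq ?_) hH⟩
  rw [show (Finset.univ.filter fun Q : Finset (Fin 4) =>
      3 ≤ (Q.image (![1, 2, 3, 4] : Fin 4 → Fin 5)).card).card = 5 by decide,
    show (Finset.univ.filter fun Q : Finset (Fin 4) =>
      4 ≤ (Q.image (![1, 2, 3, 4] : Fin 4 → Fin 5)).card).card = 1 by decide, hV]

/-- At least seven vertices: two classes besides the one of colour `0` have two vertices. -/
theorem exists_le_card_biconnectedSets_of_card_eq_add_six [Fintype V] {k : ℕ}
    (hV : Fintype.card V = k + 6) :
    ∃ H : SimpleGraph V, (2 ^ k - 1) * 33 + 9 + (k + 6) ≤ H.biconnectedSets.card := by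
  obtain ⟨H, hH⟩ := exists_le_card_biconnectedSets hV ![1, 1, 2, 2, 3, 4] (by decide)
  refine ⟨H, le_trans (le_of_eq ?_) hH⟩
  rw [show (Finset.univ.filter fun Q : Finset (Fin 6) =>
      3 ≤ (Q.image (![1, 1, 2, 2, 3, 4] : Fin 6 → Fin 5)).card).card = 33 by decide +kernel,
    show (Finset.univ.filter fun Q : Finset (Fin 6) =>
      4 ≤ (Q.image (![1, 1, 2, 2, 3, 4] : Fin 6 → Fin 5)).card).card = 9 by decide +kernel, hV]

/-- A maximiser has more biconnected sets than the bound for graphs with a pendent vertex `w` at `x`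
allows, where `a` and `b` count the neighbours and the nonneighbours of `x` other than `w`. -/
theorem two_mul_two_pow_lt_card_biconnectedSets [Fintype V] {G : SimpleGraph V}
    (hG : G.IsBiconnMax) {a b : ℕ} (hV : Fintype.card V = a + b + 2) (hab : 3 ≤ a + b) :
    2 * 2 ^ (a + b) <
      G.biconnectedSets.card + ((2 ^ a - 1) + (2 ^ b - 1) + (a + b).choose 2) := by
  have ha := Nat.one_le_two_pow (n := a)
  have hb := Nat.one_le_two_pow (n := b)
  -- `2 ^ a + 2 ^ b` is smallest when `a` and `b` are balanced.
  have hsq : 4 * 2 ^ (a + b) ≤ (2 ^ a + 2 ^ b) ^ 2 := by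
    rw [pow_add]
    exact (mul_assoc _ _ _).symm.le.trans (four_mul_le_sq_add _ _)
  rcases Nat.lt_or_ge (a + b) 5 with h5 | h5
  · obtain ⟨k, hk⟩ : ∃ k, a + b = k + 2 := ⟨a + b - 2, by omega⟩
    obtain ⟨H, hH⟩ := exists_le_card_biconnectedSets_of_card_eq_add_four (V := V) (k := k)
      (by omega)
    have := hG H
    rw [hk] at hsq ⊢
    obtain rfl | rfl : k = 1 ∨ k = 2 := by omega
    · have : 6 ≤ 2 ^ a + 2 ^ b := by
        by_contra! h
        have := hsq.trans (Nat.pow_le_pow_left (show 2 ^ a + 2 ^ b ≤ 5 by omega) 2)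
        norm_num at this
      norm_num [Nat.choose] at *
      omega
    · have : 8 ≤ 2 ^ a + 2 ^ b := by
        by_contra! h
        have := hsq.trans (Nat.pow_le_pow_left (show 2 ^ a + 2 ^ b ≤ 7 by omega) 2)
        norm_num at this
      norm_num [Nat.choose] at *
      omega
  · obtain ⟨k, hk⟩ : ∃ k, a + b = k + 5 := ⟨a + b - 5, by omega⟩
    obtain ⟨H, hH⟩ := exists_le_card_biconnectedSets_of_card_eq_add_six (V := V) (k := k + 1)
      (by omega)
    have := hG H
    rw [hk] at hsq ⊢
    have h8 : 11 ≤ 2 ^ a + 2 ^ b := by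
      have := Nat.one_le_two_pow (n := k)
      rw [pow_add] at hsq
      by_contra! h
      have : 2 ^ a + 2 ^ b ≤ 10 := by omega
      nlinarith
    have hch : 10 ≤ (k + 5).choose 2 := (Nat.choose_le_choose 2 (by omega : 5 ≤ k + 5))
    have := Nat.one_le_two_pow (n := k)
    rw [pow_succ] at hH
    rw [pow_add]
    omega

end

section

variable {V : Type*} {G : SimpleGraph V}

theorem ne_of_adj_iff_eq {x w : V} (hw : ∀ z, G.Adj w z ↔ z = x) : x ≠ w :=
  fun h => G.irrefl ((hw w).2 h.symm)

variable [Fintype V]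

/-! ### Pendent and isolated vertices -/

open Classical in
/-- The neighbours of `x` other than its pendent neighbour `w`. -/
noncomputable def nearVertices (G : SimpleGraph V) (x w : V) : Finset V :=
  {z | z ≠ w ∧ G.Adj x z}

open Classical in
/-- The vertices other than `x` and `w` that are not adjacent to `x`. -/
noncomputable def farVertices (G : SimpleGraph V) (x w : V) : Finset V :=
  {z | z ≠ w ∧ z ≠ x ∧ ¬ G.Adj x z}

theorem mem_nearVertices {x w z : V} : z ∈ G.nearVertices x w ↔ z ≠ w ∧ G.Adj x z := by
  simp [nearVertices]

theorem mem_farVertices {x w z : V} :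
    z ∈ G.farVertices x w ↔ z ≠ w ∧ z ≠ x ∧ ¬ G.Adj x z := by
  simp [farVertices]

theorem disjoint_nearVertices_farVertices {x w : V} :
    Disjoint (G.nearVertices x w) (G.farVertices x w) := by
  rw [Finset.disjoint_left]
  intro z hz hz'
  exact (mem_farVertices.1 hz').2.2 (mem_nearVertices.1 hz).2

theorem card_eq_card_near_add_card_far {x w : V} (hxw : x ≠ w) :
    Fintype.card V = (G.nearVertices x w).card + (G.farVertices x w).card + 2 := by
  classical
  rw [← Finset.card_union_of_disjoint disjoint_nearVertices_farVertices,
    ← Finset.card_pair hxw, ← Finset.card_union_of_disjoint, ← Finset.card_univ]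
  · congr 1
    ext z
    simp only [Finset.mem_univ, Finset.mem_union, mem_nearVertices, mem_farVertices,
      Finset.mem_insert, Finset.mem_singleton, true_iff]
    tauto
  · rw [Finset.disjoint_right]
    intro z hz
    simp only [Finset.mem_insert, Finset.mem_singleton] at hz
    simp only [Finset.mem_union, mem_nearVertices, mem_farVertices]
    rintro (h | h) <;> rcases hz with rfl | rfl
    · exact G.irrefl h.2
    · exact h.1 rfl
    · exact h.2.1 rfl
    · exact h.1 rfl

/-- The graph obtained from `G` by making `w` an antitwin of `x`: the new neighbours of `w` are the
vertices, other than `x`, that are not adjacent to `x`. -/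
def antitwin (G : SimpleGraph V) (x w : V) : SimpleGraph V where
  Adj a b := (a ≠ w ∧ b ≠ w ∧ G.Adj a b) ∨ (a = w ∧ b ∈ G.farVertices x w) ∨
    (b = w ∧ a ∈ G.farVertices x w)
  symm := ⟨fun a b h => by rw [G.adj_comm]; tauto⟩
  loopless := ⟨fun a h => by
    rcases h with h | ⟨rfl, h⟩ | ⟨rfl, h⟩
    · exact G.irrefl h.2.2
    · exact (mem_farVertices.1 h).1 rfl
    · exact (mem_farVertices.1 h).1 rfl⟩

theorem antitwin_adj_of_ne {x w a b : V} (ha : a ≠ w) (hb : b ≠ w) :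
    (G.antitwin x w).Adj a b ↔ G.Adj a b := by
  simp [antitwin, ha, hb]

theorem antitwin_adj {x w z : V} : (G.antitwin x w).Adj w z ↔ z ∈ G.farVertices x w := by
  simp only [antitwin, ne_eq, not_true, false_and, true_and, false_or, or_iff_left_iff_imp]
  rintro ⟨rfl, h⟩
  exact h

theorem antitwin_compl_adj_of_ne {x w a b : V} (ha : a ≠ w) (hb : b ≠ w) :
    (G.antitwin x w)ᶜ.Adj a b ↔ Gᶜ.Adj a b := by
  rw [compl_adj, compl_adj, antitwin_adj_of_ne ha hb]

theorem antitwin_compl_adj {x w z : V} (hxw : x ≠ w) :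
    (G.antitwin x w)ᶜ.Adj w z ↔ z = x ∨ z ∈ G.nearVertices x w := by
  rw [compl_adj, antitwin_adj, mem_nearVertices, mem_farVertices]
  constructor
  · rintro ⟨h, h'⟩
    tauto
  · rintro (rfl | h)
    · exact ⟨hxw.symm, by simp⟩
    · exact ⟨h.1.symm, by tauto⟩

section Pendent

variable {x w : V} (hw : ∀ z, G.Adj w z ↔ z = x)
include hw

theorem eq_singleton_of_mem_biconnectedSets {S : Finset V} (hS : S ∈ G.biconnectedSets)
    (hwS : w ∈ S) (hxS : x ∉ S) : S = {w} := by
  by_contra hne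
  obtain ⟨z, hz, hzw⟩ : ∃ z ∈ S, z ≠ w := by
    by_contra! h
    exact hne (Finset.eq_singleton_iff_unique_mem.2 ⟨hwS, h⟩)
  obtain ⟨y, hy, hwy⟩ := (mem_biconnectedSets.1 hS).1.exists_adj_of_ne hwS hz hzw.symm
  exact hxS ((hw y).1 hwy ▸ hy)

theorem exists_mem_farVertices {S : Finset V} (hS : S ∈ G.biconnectedSets)
    (hxS : x ∈ S) (hne : S ≠ {x}) : ∃ z ∈ S, z ∈ G.farVertices x w := by
  obtain ⟨z, hz, hzx⟩ : ∃ z ∈ S, z ≠ x := by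
    by_contra! h
    exact hne (Finset.eq_singleton_iff_unique_mem.2 ⟨hxS, h⟩)
  obtain ⟨y, hy, hxy⟩ := (mem_biconnectedSets.1 hS).2.exists_adj_of_ne hxS hz hzx.symm
  rw [compl_adj] at hxy
  refine ⟨y, hy, mem_farVertices.2 ⟨?_, hxy.1.symm, hxy.2⟩⟩
  rintro rfl
  exact hxy.2 ((hw x).2 rfl).symm

theorem exists_mem_nearVertices {S : Finset V} (hS : S ∈ G.biconnectedSets)
    (hxS : x ∈ S) (hne : S ≠ {x}) : ∃ z ∈ S, z ∈ G.nearVertices x w := by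
  obtain ⟨b, hbS, hb⟩ := exists_mem_farVertices hw hS hxS hne
  rw [mem_farVertices] at hb
  by_contra! h
  have hsub := (mem_biconnectedSets.1 hS).1.subset_of_closed (C := {x, w}) hxS (by simp) ?_
  · rcases hsub hbS with h' | h'
    · exact hb.2.1 h'
    · exact hb.1 h'
  · rintro u - v hv huv (rfl | rfl)
    · by_cases hvw : v = w
      · exact .inr hvw
      · exact absurd (mem_nearVertices.2 ⟨hvw, huv⟩) (h v hv)
    · exact .inl ((hw v).1 huv)

/-- Walks between vertices other than the pendent vertex `w` can avoid `w`, so they survive its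
replacement by an antitwin of `x`. -/
theorem reachIn_antitwin {S : Finset V} (hS : S ∈ G.biconnectedSets)
    (hxS : x ∈ S) {a b : V} (ha : a ∈ S) (hb : b ∈ S) (haw : a ≠ w) (hbw : b ≠ w) :
    (G.antitwin x w).ReachIn S a b := by
  classical
  have hxw := ne_of_adj_iff_eq hw
  have := ((mem_biconnectedSets.1 hS).1.reachIn ha hb).map (H := G.antitwin x w) (T := S)
    (fun v => if v = w then x else v) ?_ ?_
  · simpa [haw, hbw] using this
  · intro v hv
    split_ifs
    · exact hxS
    · exact hv
  · intro u hu v hv huv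
    split_ifs with h h' h'
    · exact .refl hxS
    · rw [h, hw] at huv
      rw [huv]
      exact .refl hxS
    · rw [h', G.adj_comm, hw] at huv
      rw [huv]
      exact .refl hxS
    · exact .of_adj ((antitwin_adj_of_ne h h').2 huv) hu hv

/-- Making the pendent vertex `w` an antitwin of its neighbour `x` keeps every biconnected set:
such a set with `w` and `x` meets the far vertices, to which `w` is now adjacent, and in the
complement `w` is adjacent to `x` and to the near vertices, `x` to the far ones. -/
theorem biconnectedSets_subset_antitwin :
    G.biconnectedSets ⊆ (G.antitwin x w).biconnectedSets := by
  intro S hS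
  have hxw := ne_of_adj_iff_eq hw
  by_cases hwS : w ∈ S
  swap
  · have hne : ∀ a ∈ S, a ≠ w := fun a ha h => hwS (h ▸ ha)
    rw [mem_biconnectedSets] at hS ⊢
    exact ⟨hS.1.transfer fun a ha b hb h =>
        .of_adj ((antitwin_adj_of_ne (hne a ha) (hne b hb)).2 h) ha hb,
      hS.2.transfer fun a ha b hb h =>
        .of_adj ((antitwin_compl_adj_of_ne (hne a ha) (hne b hb)).2 h) ha hb⟩
  by_cases hxS : x ∈ S
  swap
  · rw [eq_singleton_of_mem_biconnectedSets hw hS hwS hxS]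
    exact singleton_mem_biconnectedSets _ _
  have hne : S ≠ {x} := by
    rintro rfl
    exact hxw.symm (Finset.mem_singleton.1 hwS)
  obtain ⟨b, hbS, hb⟩ := exists_mem_farVertices hw hS hxS hne
  rw [mem_biconnectedSets]
  constructor
  · refine connected_induce_of_reachIn (r := x) hxS fun z hz => ?_
    by_cases hzw : z = w
    · subst hzw
      exact (ReachIn.of_adj (antitwin_adj.2 hb) hz hbS).trans
        (reachIn_antitwin hw hS hxS hbS hxS (mem_farVertices.1 hb).1 hxw)
    · exact reachIn_antitwin hw hS hxS hz hxS hzw hxw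
  · refine connected_induce_of_reachIn (r := x) hxS fun z hz => ?_
    have hwx : (G.antitwin x w)ᶜ.Adj w x := (antitwin_compl_adj hxw).2 (.inl rfl)
    by_cases hzx : z = x
    · subst hzx
      exact .refl hz
    by_cases hzw : z = w
    · subst hzw
      exact .of_adj hwx hz hxS
    by_cases hxz : G.Adj x z
    · have : (G.antitwin x w)ᶜ.Adj w z :=
        (antitwin_compl_adj hxw).2 (.inr (mem_nearVertices.2 ⟨hzw, hxz⟩))
      exact .of_adj₂ this.symm hwx hz hwS hxS
    · refine .of_adj ((antitwin_compl_adj_of_ne hzw hxw).2 ?_) hz hxS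
      rw [compl_adj, G.adj_comm]
      exact ⟨hzx, hxz⟩

/-- In a maximiser no biconnected set without `x` and `w` has both near and far vertices:
otherwise it could be extended by the antitwin `w` of `x`, and this extension is new. -/
theorem IsBiconnMax.not_near_and_far (hG : G.IsBiconnMax) {S : Finset V}
    (hS : S ∈ G.biconnectedSets) (hxS : x ∉ S) (hwS : w ∉ S) {n b : V} (hn : n ∈ S)
    (hn' : n ∈ G.nearVertices x w) (hb : b ∈ S) (hb' : b ∈ G.farVertices x w) : False := by
  classical
  have hxw := ne_of_adj_iff_eq hw
  have hmem : insert w S ∈ (G.antitwin x w).biconnectedSets := by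
    have hS' := biconnectedSets_subset_antitwin hw hS
    rw [mem_biconnectedSets] at hS' ⊢
    have aux : ∀ {H : SimpleGraph V} {v : V}, (H.induce (S : Set V)).Connected → v ∈ S →
        H.Adj w v → (H.induce ((insert w S : Finset V) : Set V)).Connected := by
      intro H v hH hv hwv
      have hsub : ∀ z ∈ (S : Set V), z ∈ ((insert w S : Finset V) : Set V) :=
        fun z hz => Finset.mem_insert_of_mem hz
      have hwmem : w ∈ ((insert w S : Finset V) : Set V) := Finset.mem_insert_self _ _
      refine connected_induce_of_reachIn hwmem fun z hz => ?_
      rcases Finset.mem_insert.1 hz with rfl | hz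
      · exact .refl hwmem
      · exact ((hH.reachIn hz hv).map id hsub fun a ha b hb h =>
          .of_adj h (hsub a ha) (hsub b hb)).trans (.of_adj hwv.symm (hsub v hv) hwmem)
    exact ⟨aux hS'.1 hb (antitwin_adj.2 hb'), aux hS'.2 hn ((antitwin_compl_adj hxw).2 (.inr hn'))⟩
  rw [← hG.eq_of_subset (biconnectedSets_subset_antitwin hw)] at hmem
  have := eq_singleton_of_mem_biconnectedSets hw hmem (Finset.mem_insert_self _ _)
    (by simp [hxS, hxw])
  have hnw := Finset.mem_insert_of_mem (b := w) hn
  rw [this, Finset.mem_singleton] at hnw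
  exact hwS (hnw ▸ hn)

end Pendent

end

section

variable {V : Type*} {G : SimpleGraph V}

theorem sup_edge_adj {u v a b : V} (huv : u ≠ v) :
    (G ⊔ edge u v).Adj a b ↔ G.Adj a b ∨ (a = u ∧ b = v) ∨ (a = v ∧ b = u) := by
  rw [sup_adj, edge_adj]
  constructor
  · tauto
  · rintro (h | ⟨rfl, rfl⟩ | ⟨rfl, rfl⟩)
    · exact .inl h
    · exact .inr ⟨by simp, huv⟩
    · exact .inr ⟨by simp, huv.symm⟩

variable [Fintype V]

theorem card_ne_two_of_mem_biconnectedSets {S : Finset V}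
    (hS : S ∈ G.biconnectedSets) : S.card ≠ 2 := by
  classical
  intro h
  obtain ⟨a, b, hab, rfl⟩ := Finset.card_eq_two.1 h
  rw [mem_biconnectedSets] at hS
  obtain ⟨z, hz, haz⟩ := hS.1.exists_adj_of_ne (a := a) (b := b) (by simp) (by simp) hab
  obtain ⟨z', hz', haz'⟩ := hS.2.exists_adj_of_ne (a := a) (b := b) (by simp) (by simp) hab
  simp only [Finset.coe_insert, Finset.coe_singleton, Set.mem_insert_iff,
    Set.mem_singleton_iff] at hz hz'
  obtain rfl : z = b := hz.resolve_left haz.ne'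
  obtain rfl : z' = z := hz'.resolve_left haz'.ne'
  exact ((compl_adj _ _ _).1 haz').2 haz

section Pendent

variable {x w : V} (hw : ∀ z, G.Adj w z ↔ z = x)
include hw

open Classical in
/-- In a maximiser with a pendent vertex `w`, at most two biconnected sets have a given trace `T`
on the vertices other than `w` and its neighbour `x`: `{x}` and `{w}` have empty trace, a trace
inside the near or inside the far vertices is the set itself, and any other trace leaves the choices
`T ∪ {x}` and `T ∪ {x, w}`. Traces with two elements lose one more, as biconnected sets never have
two or three elements. -/
theorem IsBiconnMax.card_trace_le (hG : G.IsBiconnMax) (T : Finset V)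
    (hT : T ⊆ G.nearVertices x w ∪ G.farVertices x w) :
    (G.biconnectedSets.filter fun S =>
        S ∩ (G.nearVertices x w ∪ G.farVertices x w) = T).card +
      ((if T ≠ ∅ ∧ T ⊆ G.nearVertices x w then 1 else 0) +
        (if T ≠ ∅ ∧ T ⊆ G.farVertices x w then 1 else 0) + (if T.card = 2 then 1 else 0)) ≤ 2 := by
  set N := G.nearVertices x w with hN
  set B := G.farVertices x w with hB
  have hxw := ne_of_adj_iff_eq hw
  have hNB : Disjoint N B := disjoint_nearVertices_farVertices
  have hcover : ∀ z, z = x ∨ z = w ∨ z ∈ N ∨ z ∈ B := by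
    intro z
    rw [hN, hB, mem_nearVertices, mem_farVertices]
    tauto
  set F := G.biconnectedSets.filter fun S => S ∩ (N ∪ B) = T with hF
  have hmemF : ∀ {S}, S ∈ F → S ∈ G.biconnectedSets ∧ ∀ z, z ∈ T ↔ z ∈ S ∧ (z ∈ N ∨ z ∈ B) := by
    intro S hS
    obtain ⟨h, rfl⟩ := Finset.mem_filter.1 hS
    exact ⟨h, fun z => by simp⟩
  have hxNB : x ∉ N ∧ x ∉ B := by simp [hN, hB, mem_nearVertices, mem_farVertices]
  have hwNB : w ∉ N ∧ w ∉ B := by simp [hN, hB, mem_nearVertices, mem_farVertices]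
  have hxT : x ∉ T := fun h => by have := Finset.mem_union.1 (hT h); tauto
  have hwT : w ∉ T := fun h => by have := Finset.mem_union.1 (hT h); tauto
  rcases T.eq_empty_or_nonempty with rfl | hne
  · have hsub : F ⊆ {{x}, {w}} := by
      intro S hS
      obtain ⟨hS, htr⟩ := hmemF hS
      have hnone : ∀ z ∈ S, z ∉ N ∧ z ∉ B := fun z hz => by
        have := (htr z).2
        simp only [Finset.notMem_empty, imp_false] at this
        tauto
      by_cases hxS : x ∈ S
      · by_cases hSx : S = {x}
        · simp [hSx]
        · obtain ⟨z, hz, hzB⟩ := exists_mem_farVertices hw hS hxS hSx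
          exact absurd hzB (hnone z hz).2
      · have hwS : w ∈ S := by
          obtain ⟨z, hz⟩ := (mem_biconnectedSets.1 hS).1.nonempty
          rcases hcover z with rfl | rfl | h | h
          · exact absurd hz hxS
          · exact hz
          · exact absurd h (hnone z hz).1
          · exact absurd h (hnone z hz).2
        simp [eq_singleton_of_mem_biconnectedSets hw hS hwS hxS]
    have := (Finset.card_le_card hsub).trans Finset.card_le_two
    simpa using this
  -- A set of the fibre that contains `w` or `x` contains `x` and meets both sides.
  have hboth : ∀ {S}, S ∈ F → x ∈ S ∨ w ∈ S → x ∈ S ∧ (∃ n ∈ T, n ∈ N) ∧ ∃ b ∈ T, b ∈ B := by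
    intro S hSF hxw'
    obtain ⟨hS, htr⟩ := hmemF hSF
    obtain ⟨t, ht⟩ := hne
    have htS := (htr t).1 ht
    have hxS : x ∈ S := by
      by_contra hxS
      have := eq_singleton_of_mem_biconnectedSets hw hS (hxw'.resolve_left hxS) hxS
      rw [this, Finset.mem_singleton] at htS
      exact hwT (htS.1 ▸ ht)
    have hSx : S ≠ {x} := by
      rintro rfl
      exact hxT (Finset.mem_singleton.1 htS.1 ▸ ht)
    obtain ⟨n, hn, hnN⟩ := exists_mem_nearVertices hw hS hxS hSx
    obtain ⟨b, hb, hbB⟩ := exists_mem_farVertices hw hS hxS hSx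
    exact ⟨hxS, ⟨n, (htr n).2 ⟨hn, .inl hnN⟩, hnN⟩, b, (htr b).2 ⟨hb, .inr hbB⟩, hbB⟩
  have heq : ∀ {S}, S ∈ F → x ∉ S → w ∉ S → S = T := by
    intro S hSF hxS hwS
    ext z
    rw [(hmemF hSF).2 z]
    refine ⟨fun hz => ⟨hz, ?_⟩, And.left⟩
    rcases hcover z with rfl | rfl | h | h
    · exact absurd hz hxS
    · exact absurd hz hwS
    · exact .inl h
    · exact .inr h
  by_cases hside : T ⊆ N ∨ T ⊆ B
  · have hsub : F ⊆ {T} := by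
      intro S hSF
      by_cases h : x ∈ S ∨ w ∈ S
      · obtain ⟨-, ⟨n, hn, hnN⟩, b, hb, hbB⟩ := hboth hSF h
        rcases hside with h' | h'
        · exact absurd hbB (Finset.disjoint_left.1 hNB (h' hb))
        · exact absurd (h' hn) (Finset.disjoint_left.1 hNB hnN)
      · push Not at h
        exact Finset.mem_singleton.2 (heq hSF h.1 h.2)
    have hone : (if T ≠ ∅ ∧ T ⊆ N then 1 else 0) + (if T ≠ ∅ ∧ T ⊆ B then 1 else 0) ≤ 1 := by
      split_ifs with h h'
      · obtain ⟨t, ht⟩ := hne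
        exact absurd (h'.2 ht) (Finset.disjoint_left.1 hNB (h.2 ht))
      all_goals simp
    by_cases h2 : T.card = 2
    · have : F = ∅ := by
        refine Finset.eq_empty_of_forall_notMem fun S hSF => ?_
        have hST := Finset.mem_singleton.1 (hsub hSF)
        exact card_ne_two_of_mem_biconnectedSets (hmemF hSF).1 (hST ▸ h2)
      rw [this, if_pos h2, Finset.card_empty]
      omega
    · have := Finset.card_le_card hsub
      rw [Finset.card_singleton] at this
      rw [if_neg h2]
      omega
  · push Not at hside
    rw [if_neg (fun h => hside.1 h.2), if_neg (fun h => hside.2 h.2)]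
    have hnN : ∃ n ∈ T, n ∈ N := by
      obtain ⟨n, hn, hnB⟩ := Finset.not_subset.1 hside.2
      exact ⟨n, hn, (Finset.mem_union.1 (hT hn)).resolve_right hnB⟩
    have hbB : ∃ b ∈ T, b ∈ B := by
      obtain ⟨b, hb, hbN⟩ := Finset.not_subset.1 hside.1
      exact ⟨b, hb, (Finset.mem_union.1 (hT hb)).resolve_left hbN⟩
    obtain ⟨n, hn, hnN⟩ := hnN
    obtain ⟨b, hb, hbB⟩ := hbB
    have hxS : ∀ {S}, S ∈ F → x ∈ S := by
      intro S hSF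
      by_contra hxS
      by_cases hwS : w ∈ S
      · exact hxS (hboth hSF (.inr hwS)).1
      · obtain ⟨hS, htr⟩ := hmemF hSF
        exact hG.not_near_and_far hw hS hxS hwS ((htr n).1 hn).1 hnN ((htr b).1 hb).1 hbB
    have hST : ∀ {S}, S ∈ F → S = insert x T ∨ S = insert w (insert x T) := by
      intro S hSF
      obtain ⟨hS, htr⟩ := hmemF hSF
      have hx := hxS hSF
      by_cases hwS : w ∈ S
      · right
        ext z
        rw [Finset.mem_insert, Finset.mem_insert, htr]
        refine ⟨fun hz => ?_, ?_⟩
        · have := hcover z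
          tauto
        · rintro (rfl | rfl | h)
          exacts [hwS, hx, h.1]
      · left
        ext z
        rw [Finset.mem_insert, htr]
        refine ⟨fun hz => ?_, ?_⟩
        · rcases hcover z with h | rfl | h | h
          exacts [.inl h, absurd hz hwS, .inr ⟨hz, .inl h⟩, .inr ⟨hz, .inr h⟩]
        · rintro (rfl | h)
          exacts [hx, h.1]
    by_cases h2 : T.card = 2
    · -- `{x, n, b}` is not biconnected, as `n` would need both a neighbour and a nonneighbour `b`.
      have hTnb : T = {n, b} := by
        have hnb : n ≠ b := fun h => Finset.disjoint_left.1 hNB hnN (h ▸ hbB)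
        refine (Finset.eq_of_subset_of_card_le ?_ ?_).symm
        · intro z hz
          rcases Finset.mem_insert.1 hz with rfl | hz
          · exact hn
          · exact Finset.mem_singleton.1 hz ▸ hb
        · rw [h2, Finset.card_pair hnb]
      have hsub : F ⊆ {insert w (insert x T)} := by
        intro S hSF
        rcases hST hSF with h | h
        · exfalso
          obtain ⟨hS, -⟩ := hmemF hSF
          rw [mem_biconnectedSets] at hS
          rw [hN, mem_nearVertices] at hnN
          rw [hB, mem_farVertices] at hbB
          have hm : ∀ z, z ∈ (S : Set V) ↔ z = x ∨ z = n ∨ z = b := by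
            intro z
            rw [h, hTnb]
            simp
          have hxn : n ≠ x := hnN.2.ne'
          obtain ⟨y, hy, hby⟩ := hS.1.exists_adj_of_ne ((hm b).2 (by simp)) ((hm x).2 (by simp))
            hbB.2.1
          obtain ⟨y', hy', hny'⟩ := hS.2.exists_adj_of_ne ((hm n).2 (by simp))
            ((hm x).2 (by simp)) hxn
          rw [compl_adj] at hny'
          rcases (hm y).1 hy with rfl | rfl | rfl
          · exact hbB.2.2 hby.symm
          · rcases (hm y').1 hy' with rfl | rfl | rfl
            · exact hny'.2 hnN.2.symm
            · exact hny'.1 rfl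
            · exact hny'.2 hby.symm
          · exact G.irrefl hby
        · exact Finset.mem_singleton.2 h
      have := Finset.card_le_card hsub
      rw [Finset.card_singleton] at this
      rw [if_pos h2]
      omega
    · have hsub : F ⊆ {insert x T, insert w (insert x T)} := by
        intro S hSF
        simpa using hST hSF
      have := (Finset.card_le_card hsub).trans Finset.card_le_two
      rw [if_neg h2]
      omega

/-- The bounds for the single traces, added up. -/
theorem IsBiconnMax.card_biconnectedSets_le (hG : G.IsBiconnMax) :
    G.biconnectedSets.card + ((2 ^ (G.nearVertices x w).card - 1) +
      (2 ^ (G.farVertices x w).card - 1) +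
        ((G.nearVertices x w).card + (G.farVertices x w).card).choose 2) ≤
      2 * 2 ^ ((G.nearVertices x w).card + (G.farVertices x w).card) := by
  classical
  set N := G.nearVertices x w with hN
  set B := G.farVertices x w with hB
  have hNB : Disjoint N B := disjoint_nearVertices_farVertices
  have hcard : (N ∪ B).card = N.card + B.card := Finset.card_union_of_disjoint hNB
  have hsides : ∀ M ⊆ N ∪ B,
      ∑ T ∈ (N ∪ B).powerset, (if T ≠ ∅ ∧ T ⊆ M then 1 else 0) = 2 ^ M.card - 1 := by
    intro M hM
    rw [← Finset.card_filter, ← Finset.card_powerset,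
      ← Finset.card_erase_of_mem (Finset.empty_mem_powerset M)]
    congr 1
    ext T
    simp only [Finset.mem_filter, Finset.mem_powerset, Finset.mem_erase]
    exact ⟨And.right, fun h => ⟨h.2.trans hM, h⟩⟩
  have hpairs : ∑ T ∈ (N ∪ B).powerset, (if T.card = 2 then 1 else 0) =
      (N.card + B.card).choose 2 := by
    rw [← Finset.card_filter, ← hcard, ← Finset.card_powersetCard,
      Finset.powersetCard_eq_filter]
  have hfib := Finset.card_eq_sum_card_fiberwise (s := G.biconnectedSets)
    (t := (N ∪ B).powerset) (f := fun S => S ∩ (N ∪ B))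
    (fun S _ => Finset.mem_coe.2 (Finset.mem_powerset.2 Finset.inter_subset_right))
  rw [hfib, ← hsides N Finset.subset_union_left, ← hsides B Finset.subset_union_right, ← hpairs,
    ← Finset.sum_add_distrib, ← Finset.sum_add_distrib, ← Finset.sum_add_distrib, ← hcard,
    mul_comm, ← Finset.card_powerset, ← smul_eq_mul]
  exact Finset.sum_le_card_nsmul _ _ _ fun T hT => by
    convert hG.card_trace_le hw T (Finset.mem_powerset.1 hT)

theorem IsBiconnMax.not_pendent (hG : G.IsBiconnMax) (hn : 4 < Fintype.card V) : False := by
  have hV := G.card_eq_card_near_add_card_far (ne_of_adj_iff_eq hw)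
  exact absurd (hG.card_biconnectedSets_le hw)
    (two_mul_two_pow_lt_card_biconnectedSets hG hV (by omega)).not_ge

end Pendent

/-- An isolated vertex could be made pendent without losing a biconnected set. -/
theorem IsBiconnMax.exists_adj (hG : G.IsBiconnMax) (hn : 4 < Fintype.card V) (w : V) :
    ∃ z, G.Adj w z := by
  classical
  by_contra! hw
  have : Nontrivial V := Fintype.one_lt_card_iff_nontrivial.1 (by omega)
  obtain ⟨x, hxw⟩ := exists_ne w
  have hsub : G.biconnectedSets ⊆ (G ⊔ edge w x).biconnectedSets := by
    intro S hS
    by_cases hwS : w ∈ S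
    · have : S = {w} := by
        by_contra hne
        obtain ⟨z, hz, hzw⟩ : ∃ z ∈ S, z ≠ w := by
          by_contra! h
          exact hne (Finset.eq_singleton_iff_unique_mem.2 ⟨hwS, h⟩)
        obtain ⟨y, -, hwy⟩ := (mem_biconnectedSets.1 hS).1.exists_adj_of_ne hwS hz hzw.symm
        exact hw y hwy
      rw [this]
      exact singleton_mem_biconnectedSets _ _
    · have hne : ∀ a ∈ S, a ≠ w := fun a ha h => hwS (h ▸ ha)
      rw [mem_biconnectedSets] at hS ⊢
      refine ⟨hS.1.transfer fun a ha b hb h => .of_adj (.inl h) ha hb, hS.2.transfer fun a ha b hb h => ?_⟩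
      refine .of_adj ?_ ha hb
      rw [compl_adj, sup_edge_adj hxw.symm]
      rw [compl_adj] at h
      have := hne a ha
      have := hne b hb
      tauto
  refine (hG.of_subset hsub).not_pendent (x := x) (w := w) (fun z => ?_) hn
  rw [sup_edge_adj hxw.symm]
  have := hw z
  constructor
  · rintro (h | h | h)
    · exact absurd h this
    · exact h.2
    · exact absurd h.1.symm hxw
  · exact fun h => .inr (.inl ⟨rfl, h⟩)

end

section

/-! ### Adding an edge -/

variable {V : Type*} {G : SimpleGraph V}

theorem sup_edge_compl_adj {u v a b : V} (huv : u ≠ v) :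
    (G ⊔ edge u v)ᶜ.Adj a b ↔
      a ≠ b ∧ ¬ G.Adj a b ∧ ¬ (a = u ∧ b = v) ∧ ¬ (a = v ∧ b = u) := by
  rw [compl_adj, sup_edge_adj huv]
  tauto

variable [Fintype V]

/-- If adding the edge `uv` destroys the biconnected set `S`, then `uv` is a bridge in the
complement of `G[S]`. So the complement has no walk of length two or three from `u` to `v` in `S`
that avoids this edge. -/
theorem bridge_of_mem_biconnectedSets {u v : V} (huv : u ≠ v) {S : Finset V}
    (hS : S ∈ G.biconnectedSets) (hS' : S ∉ (G ⊔ edge u v).biconnectedSets) :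
    u ∈ S ∧ v ∈ S ∧ (∀ z ∈ S, z ≠ u → z ≠ v → ¬ G.Adj z u → G.Adj z v) ∧
      ∀ z ∈ S, ∀ z' ∈ S, z ≠ u → z ≠ v → z' ≠ u → z' ≠ v → z ≠ z' →
        ¬ G.Adj z u → ¬ G.Adj z' v → G.Adj z z' := by
  have hno : u ∈ S ∧ v ∈ S ∧ ¬ (G ⊔ edge u v)ᶜ.ReachIn S u v := by
    by_contra h
    rw [mem_biconnectedSets] at hS hS'
    refine hS' ⟨hS.1.transfer fun a ha b hb hab => .of_adj (.inl hab) ha hb,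
      hS.2.transfer fun a ha b hb hab => ?_⟩
    rw [compl_adj] at hab
    by_cases h₁ : a = u ∧ b = v
    · rw [h₁.1, h₁.2]
      rw [h₁.1] at ha
      rw [h₁.2] at hb
      by_contra h'
      exact h ⟨ha, hb, h'⟩
    by_cases h₂ : a = v ∧ b = u
    · rw [h₂.1, h₂.2]
      rw [h₂.1] at ha
      rw [h₂.2] at hb
      by_contra h'
      exact h ⟨hb, ha, fun h => h' h.symm⟩
    exact .of_adj ((sup_edge_compl_adj huv).2 ⟨hab.1, hab.2, h₁, h₂⟩) ha hb
  obtain ⟨hu, hv, hno⟩ := hno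
  refine ⟨hu, hv, fun z hz hzu hzv h => ?_, fun z hz z' hz' hzu hzv hzu' hzv' hne h h' => ?_⟩
  · by_contra h'
    refine hno (.of_adj₂ (b := z) ?_ ?_ hu hz hv) <;> rw [sup_edge_compl_adj huv]
    · exact ⟨hzu.symm, fun e => h e.symm, by tauto, by tauto⟩
    · exact ⟨hzv, h', by tauto, by tauto⟩
  · by_contra h''
    refine hno (.of_adj₃ (b := z) (c := z') ?_ ?_ ?_ hu hz hz' hv) <;> rw [sup_edge_compl_adj huv]
    · exact ⟨hzu.symm, fun e => h e.symm, by tauto, by tauto⟩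
    · exact ⟨hne, h'', by tauto, by tauto⟩
    · exact ⟨hzv', h', by tauto, by tauto⟩

/-- An induced path `t - u - v - b` of `G + uv` is biconnected, and stays so if `t` is replaced by a
nonempty set `T` of vertices that are adjacent to `u` but not to `v` or `b`. -/
theorem insert_mem_biconnectedSets_sup_edge [DecidableEq V] {u v b : V} {T : Finset V}
    (hT : T.Nonempty) (huv : u ≠ v) (hub : u ≠ b) (hvb : G.Adj v b) (hub' : ¬ G.Adj u b)
    (hTu : ∀ z ∈ T, G.Adj u z) (hTv : ∀ z ∈ T, z ≠ v ∧ ¬ G.Adj z v)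
    (hTb : ∀ z ∈ T, z ≠ b ∧ ¬ G.Adj z b) :
    insert u (insert v (insert b T)) ∈ (G ⊔ edge u v).biconnectedSets := by
  obtain ⟨t, ht⟩ := hT
  set S : Finset V := insert u (insert v (insert b T)) with hS
  have hu : u ∈ S := by simp [hS]
  have hv : v ∈ S := by simp [hS]
  have hb : b ∈ S := by simp [hS]
  have htS : ∀ z ∈ T, z ∈ S := fun z hz => by simp [hS, hz]
  have hcases : ∀ z ∈ S, z = u ∨ z = v ∨ z = b ∨ z ∈ T := fun z hz => by simpa [hS] using hz
  rw [mem_biconnectedSets]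
  constructor
  · have huv' : (G ⊔ edge u v).Adj u v := (sup_edge_adj huv).2 (.inr (.inl ⟨rfl, rfl⟩))
    refine connected_induce_of_reachIn (r := u) hu fun z hz => ?_
    rcases hcases z hz with rfl | rfl | rfl | h
    · exact .refl hz
    · exact .of_adj huv'.symm hz hu
    · exact .of_adj₂ (b := v) (.inl hvb.symm) huv'.symm hz hv hu
    · exact .of_adj (.inl (hTu z h).symm) hz hu
  · have hco : ∀ {p q : V}, p ≠ q → ¬ G.Adj p q → p ≠ u ∨ q ≠ v → p ≠ v ∨ q ≠ u →
        (G ⊔ edge u v)ᶜ.Adj p q := fun h h' h₁ h₂ =>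
      (sup_edge_compl_adj huv).2 ⟨h, h', by tauto, by tauto⟩
    have hbu : (G ⊔ edge u v)ᶜ.Adj b u :=
      hco hub.symm (fun h => hub' h.symm) (.inl hub.symm) (.inl hvb.ne')
    have hTb' : ∀ z ∈ T, (G ⊔ edge u v)ᶜ.Adj z b := fun z hz =>
      hco (hTb z hz).1 (hTb z hz).2 (.inl (hTu z hz).ne') (.inr hub.symm)
    have hvt : (G ⊔ edge u v)ᶜ.Adj v t :=
      hco (hTv t ht).1.symm (fun h => (hTv t ht).2 h.symm) (.inl huv.symm) (.inr (hTu t ht).ne')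
    refine connected_induce_of_reachIn (r := b) hb fun z hz => ?_
    rcases hcases z hz with rfl | rfl | rfl | h
    · exact .of_adj hbu.symm hz hb
    · exact .of_adj₂ hvt (hTb' t ht) hz (htS t ht) hb
    · exact .refl hz
    · exact .of_adj (hTb' z h) hz hb

/-- In a maximiser any two vertices are at distance at most three. Otherwise adding the edge `uv`
destroys no biconnected set, as neighbours of `u` and of `v` in it are not adjacent, and creates an
induced path through `uv`. -/
theorem IsBiconnMax.exists_short_walk (hG : G.IsBiconnMax) (hn : 4 < Fintype.card V) {u v : V}
    (huv : u ≠ v) : G.Adj u v ∨ (∃ z, G.Adj u z ∧ G.Adj z v) ∨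
      ∃ z z', G.Adj u z ∧ G.Adj z z' ∧ G.Adj z' v := by
  classical
  by_contra! h
  obtain ⟨h₁, h₂, h₃⟩ := h
  obtain ⟨a, ha⟩ := hG.exists_adj hn u
  obtain ⟨b, hb⟩ := hG.exists_adj hn v
  have hsub : G.biconnectedSets ⊆ (G ⊔ edge u v).biconnectedSets := by
    intro S hS
    by_contra hS'
    obtain ⟨hu, hv, -, hbr⟩ := bridge_of_mem_biconnectedSets huv hS hS'
    obtain ⟨z, hz, huz⟩ := (mem_biconnectedSets.1 hS).1.exists_adj_of_ne hu hv huv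
    obtain ⟨z', hz', hvz'⟩ := (mem_biconnectedSets.1 hS).1.exists_adj_of_ne hv hu huv.symm
    have hzz' : z' ≠ z := fun e => h₂ z huz (e ▸ hvz'.symm)
    have hzv : z ≠ v := fun e => h₁ (e ▸ huz)
    have hzu' : z' ≠ u := fun e => h₁ (e ▸ hvz'.symm)
    exact h₃ z z' huz (hbr z' hz' z hz hzu' hvz'.ne' huz.ne' hzv hzz'
      (fun e => h₂ z' e.symm hvz'.symm) (h₂ z huz)).symm hvz'.symm
  have hub : u ≠ b := fun e => h₁ (e ▸ hb.symm)
  have hub' : ¬ G.Adj u b := fun e => h₂ b e hb.symm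
  have hmem : insert u (insert v (insert b {a})) ∈ (G ⊔ edge u v).biconnectedSets := by
    refine insert_mem_biconnectedSets_sup_edge (Finset.singleton_nonempty a) huv hub hb hub'
      ?_ ?_ ?_ <;> simp only [Finset.mem_singleton, forall_eq]
    · exact ha
    · exact ⟨fun e => h₁ (e ▸ ha), h₂ a ha⟩
    · exact ⟨fun e => hub' (e ▸ ha), fun e => h₃ a b ha e hb.symm⟩
  rw [← hG.eq_of_subset hsub, mem_biconnectedSets] at hmem
  have hcl := hmem.1.subset_of_closed (C := {u, a}) (a := u) (by simp) (by simp) ?_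
  · rcases hcl (show v ∈ _ by simp) with h | h
    · exact huv h.symm
    · exact h₁ (h ▸ ha)
  · rintro p - q hq hpq hp
    simp only [Finset.coe_insert, Finset.coe_singleton, Set.mem_insert_iff,
      Set.mem_singleton_iff] at hp hq ⊢
    rcases hp with rfl | rfl <;> rcases hq with rfl | rfl | rfl | rfl
    · exact .inl rfl
    · exact absurd hpq h₁
    · exact absurd hpq hub'
    · exact .inr rfl
    · exact .inl rfl
    · exact absurd hpq (h₂ _ ha)
    · exact absurd hb.symm (h₃ _ _ ha hpq)
    · exact .inr rfl

/-! ### Cut vertices -/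

/-- A maximiser has no partition of the vertices other than `x` into nonempty sets `U` and `W`
without edges between them such that `x` is adjacent to all of `W`. -/
theorem IsBiconnMax.not_dominated_part (hG : G.IsBiconnMax) (hn : 4 < Fintype.card V) {x : V}
    {U W : Set V} (hcover : ∀ z, z = x ∨ z ∈ U ∨ z ∈ W) (hxU : x ∉ U) (hxW : x ∉ W)
    (hUW : ∀ z ∈ U, ∀ z' ∈ W, z ≠ z' ∧ ¬ G.Adj z z') (hW : W.Nonempty)
    (hdom : ∀ z ∈ W, G.Adj x z) : False := by
  classical
  obtain ⟨u, hxu⟩ := hG.compl.exists_adj hn x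
  rw [compl_adj] at hxu
  have huU : u ∈ U := by
    rcases hcover u with h | h | h
    · exact absurd h.symm hxu.1
    · exact h
    · exact absurd (hdom u h) hxu.2
  by_cases hdeg : ∃ w ∈ W, ∃ w₁ ∈ W, ∃ w₂ ∈ W, w₁ ≠ w₂ ∧ G.Adj w w₁ ∧ G.Adj w w₂
  · -- Add the edge `uw`. A set `S` destroyed by this contains `x`, and `S` with `x` replaced by
    -- `w₁` is new. So is the set in which `w₂` takes the place of `w₁`.
    obtain ⟨w, hw, w₁, hw₁, w₂, hw₂, hne, hww₁, hww₂⟩ := hdeg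
    have huw : u ≠ w := (hUW u huU w hw).1
    have hwx : x ≠ w := fun h => hxW (h ▸ hw)
    have hnbr : ∀ {z}, G.Adj u z → z ∈ U := by
      intro z huz
      rcases hcover z with h | h | h
      · exact absurd (h ▸ huz.symm) hxu.2
      · exact h
      · exact absurd huz (hUW u huU z h).2
    have hnew : ∀ y ∈ W, G.Adj w y → ∀ T : Finset V, T.Nonempty → (∀ z ∈ T, G.Adj u z) →
        insert u (insert w (insert y T)) ∈ (G ⊔ edge u w).biconnectedSets ∧
        insert u (insert w (insert y T)) ∉ G.biconnectedSets := by
      intro y hy hwy T hT hTu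
      refine ⟨insert_mem_biconnectedSets_sup_edge hT huw (hUW u huU y hy).1 hwy
        (hUW u huU y hy).2 hTu (fun z hz => hUW z (hnbr (hTu z hz)) w hw)
        (fun z hz => hUW z (hnbr (hTu z hz)) y hy), fun hmem => ?_⟩
      have hcl := (mem_biconnectedSets.1 hmem).1.subset_of_closed (C := U) (a := u) (by simp)
        huU ?_
      · exact (hUW w (hcl (by simp)) w hw).1 rfl
      · intro p _ q hq hpq hp
        simp only [Finset.coe_insert, Set.mem_insert_iff, Finset.mem_coe] at hq
        rcases hq with rfl | rfl | rfl | h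
        · exact huU
        · exact absurd hpq (hUW p hp _ hw).2
        · exact absurd hpq (hUW p hp _ hy).2
        · exact hnbr (hTu q h)
    have hlost : ∀ S ∈ G.biconnectedSets \ (G ⊔ edge u w).biconnectedSets,
        ∃ T : Finset V, T.Nonempty ∧ (∀ z ∈ T, G.Adj u z) ∧
          S = insert u (insert w (insert x T)) := by
      intro S hS
      obtain ⟨hS, hS'⟩ := Finset.mem_sdiff.1 hS
      obtain ⟨hu, hw', hbr₁, hbr₂⟩ := bridge_of_mem_biconnectedSets huw hS hS'
      have hconn := (mem_biconnectedSets.1 hS).1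
      have hx : x ∈ S := by
        by_contra hx
        have hcl := hconn.subset_of_closed (C := U) hu huU ?_
        · exact (hUW w (hcl hw') w hw).1 rfl
        · intro p _ q hq hpq hp
          rcases hcover q with h | h | h
          · exact absurd (h ▸ hq) hx
          · exact h
          · exact absurd hpq (hUW p hp q h).2
      obtain ⟨t, ht, hut⟩ := hconn.exists_adj_of_ne hu hw' huw
      have htU := hnbr hut
      have hall : ∀ z ∈ S, z ≠ u → z ≠ w → z ≠ x → G.Adj u z := by
        intro z hz hzu hzw hzx
        by_contra hno
        rcases hcover z with h | h | h
        · exact hzx h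
        · exact (hUW z h w hw).2 (hbr₁ z hz hzu hzw fun e => hno e.symm)
        · exact (hUW t htU z h).2 (hbr₂ z hz t ht hzu hzw hut.ne' (hUW t htU w hw).1
            (hUW t htU z h).1.symm (fun e => hno e.symm) (hUW t htU w hw).2).symm
      refine ⟨((S.erase u).erase w).erase x, ⟨t, ?_⟩, fun z hz => ?_, ?_⟩
      · simp only [Finset.mem_erase]
        exact ⟨fun h => hxU (h ▸ htU), (hUW t htU w hw).1, hut.ne', ht⟩
      · simp only [Finset.mem_erase] at hz
        exact hall z hz.2.2.2 hz.2.2.1 hz.2.1 hz.1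
      · ext z
        simp only [Finset.mem_insert, Finset.mem_erase]
        constructor
        · tauto
        · rintro (rfl | rfl | rfl | h)
          exacts [hu, hw', hx, h.2.2.2]
    obtain ⟨t, ht⟩ := hG.exists_adj hn u
    have hcard : (G.biconnectedSets \ (G ⊔ edge u w).biconnectedSets).card <
        ((G ⊔ edge u w).biconnectedSets \ G.biconnectedSets).card := by
      have hnotin : ∀ y ∈ W, ∀ T : Finset V, (∀ z ∈ T, G.Adj u z) → y ∉ T := fun y hy T hT h =>
        (hUW y (hnbr (hT y h)) y hy).1 rfl
      have hw₁u : w₁ ≠ u := (hUW u huU w₁ hw₁).1.symm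
      have hw₁x : w₁ ≠ x := fun h => hxW (h ▸ hw₁)
      have hswap : ∀ T : Finset V, (∀ z ∈ T, G.Adj u z) →
          insert w₁ ((insert u (insert w (insert x T))).erase x) =
            insert u (insert w (insert w₁ T)) := by
        intro T hT
        have hxT : x ∉ T := fun h => hxU (hnbr (hT x h))
        ext z
        simp only [Finset.mem_insert, Finset.mem_erase]
        by_cases hzx : z = x
        · rw [hzx]
          have := hxu.1
          tauto
        · tauto
      have hback : ∀ T : Finset V, (∀ z ∈ T, G.Adj u z) →
          insert x ((insert u (insert w (insert w₁ T))).erase w₁) =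
            insert u (insert w (insert x T)) := by
        intro T hT
        have hT' := hnotin w₁ hw₁ T hT
        ext z
        simp only [Finset.mem_insert, Finset.mem_erase]
        by_cases hz : z = w₁
        · rw [hz]
          have := hww₁.ne'
          tauto
        · tauto
      have hextra := hnew w₂ hw₂ hww₂ {t} (Finset.singleton_nonempty t) (by simpa using ht)
      refine lt_of_le_of_lt ?_ (Finset.card_erase_lt_of_mem (Finset.mem_sdiff.2 hextra))
      refine Finset.card_le_card_of_injOn (fun S => insert w₁ (S.erase x)) ?_ ?_
      · intro S hS
        obtain ⟨T, hT, hTu, rfl⟩ := hlost S hS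
        dsimp only
        rw [hswap T hTu]
        refine Finset.mem_coe.2 (Finset.mem_erase.2
          ⟨fun h => ?_, Finset.mem_sdiff.2 (hnew w₁ hw₁ hww₁ T hT hTu)⟩)
        have hmem : w₁ ∈ insert u (insert w (insert w₂ ({t} : Finset V))) := by
          rw [← h]
          simp
        simp only [Finset.mem_insert, Finset.mem_singleton] at hmem
        rcases hmem with h | h | h | h
        · exact hw₁u h
        · exact hww₁.ne' h
        · exact hne h
        · exact (hUW t (hnbr ht) w₁ hw₁).1 h.symm
      · intro S hS S' hS' h
        obtain ⟨T, -, hTu, rfl⟩ := hlost S hS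
        obtain ⟨T', -, hTu', rfl⟩ := hlost S' hS'
        dsimp only at h
        rw [hswap T hTu, hswap T' hTu'] at h
        rw [← hback T hTu, ← hback T' hTu', h]
    have h₁ := Finset.card_sdiff_add_card_inter G.biconnectedSets (G ⊔ edge u w).biconnectedSets
    have h₂ := Finset.card_sdiff_add_card_inter (G ⊔ edge u w).biconnectedSets G.biconnectedSets
    rw [Finset.inter_comm] at h₂
    have := hG (G ⊔ edge u w)
    omega
  push Not at hdeg
  obtain ⟨w, hw⟩ := hW
  have hout : ∀ {y z}, y ∈ W → G.Adj y z → z = x ∨ z ∈ W := by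
    intro y z hy hyz
    rcases hcover z with h | h | h
    · exact .inl h
    · exact absurd hyz.symm (hUW z h y hy).2
    · exact .inr h
  by_cases hex : ∃ w' ∈ W, G.Adj w w'
  · -- `w` and `w'` have the neighbours `x` and each other; deleting `ww'` makes `w` pendent.
    obtain ⟨w', hw', hww'⟩ := hex
    have hx : x ≠ w ∧ x ≠ w' := ⟨fun h => hxW (h ▸ hw), fun h => hxW (h ▸ hw')⟩
    have hadj : ∀ a b, (G.deleteEdges {s(w, w')}).Adj a b ↔
        G.Adj a b ∧ ¬ (a = w ∧ b = w') ∧ ¬ (a = w' ∧ b = w) := by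
      intro a b
      rw [deleteEdges_adj, Set.mem_singleton_iff, Sym2.eq_iff, not_or]
    have hNw : ∀ z, G.Adj w z → z = x ∨ z = w' := fun z hz =>
      (hout hw hz).imp id fun h => by
        by_contra hne
        exact hdeg w hw z h w' hw' hne hz hww'
    have hNw' : ∀ z, G.Adj w' z → z = x ∨ z = w := fun z hz =>
      (hout hw' hz).imp id fun h => by
        by_contra hne
        exact hdeg w' hw' z h w hw hne hz hww'.symm
    have hsub : G.biconnectedSets ⊆ (G.deleteEdges {s(w, w')}).biconnectedSets := by
      intro S hS
      have hxS : w ∈ S → w' ∈ S → x ∈ S := by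
        intro h h'
        by_contra hxS
        have hcl := (mem_biconnectedSets.1 hS).1.subset_of_closed (C := {w, w'}) h (by simp) ?_
        · refine card_ne_two_of_mem_biconnectedSets hS ?_
          have : S = {w, w'} := by
            refine Finset.Subset.antisymm (fun z hz => by simpa using hcl hz) fun z hz => ?_
            rcases Finset.mem_insert.1 hz with rfl | hz
            · exact h
            · exact Finset.mem_singleton.1 hz ▸ h'
          rw [this, Finset.card_pair hww'.ne]
        · rintro p - q hq hpq (rfl | rfl)
          · exact (hNw q hpq).elim (fun e => absurd (e ▸ hq) hxS) .inr
          · exact (hNw' q hpq).elim (fun e => absurd (e ▸ hq) hxS) .inl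
      rw [mem_biconnectedSets] at hS ⊢
      refine ⟨hS.1.transfer fun a ha b hb hab => ?_, hS.2.transfer fun a ha b hb hab => ?_⟩
      · have hwx : (G.deleteEdges {s(w, w')}).Adj w x :=
          (hadj _ _).2 ⟨(hdom w hw).symm, by tauto, by tauto⟩
        have hwx' : (G.deleteEdges {s(w, w')}).Adj w' x :=
          (hadj _ _).2 ⟨(hdom w' hw').symm, by tauto, by tauto⟩
        by_cases h₁ : a = w ∧ b = w'
        · obtain ⟨rfl, rfl⟩ := h₁
          exact .of_adj₂ hwx hwx'.symm ha (hxS ha hb) hb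
        by_cases h₂ : a = w' ∧ b = w
        · obtain ⟨rfl, rfl⟩ := h₂
          exact .of_adj₂ hwx' hwx.symm ha (hxS hb ha) hb
        exact .of_adj ((hadj _ _).2 ⟨hab, h₁, h₂⟩) ha hb
      · refine .of_adj ?_ ha hb
        rw [compl_adj] at hab ⊢
        rw [hadj]
        tauto
    refine (hG.of_subset hsub).not_pendent (x := x) (w := w) (fun z => ?_) hn
    rw [hadj]
    constructor
    · rintro ⟨h, h', -⟩
      exact (hNw z h).resolve_right fun e => h' ⟨rfl, e⟩
    · rintro rfl
      exact ⟨(hdom w hw).symm, by tauto, by tauto⟩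
  · push Not at hex
    refine hG.not_pendent (x := x) (w := w) (fun z => ⟨fun h => ?_, ?_⟩) hn
    · exact (hout hw h).resolve_right fun hz => hex z hz h
    · rintro rfl
      exact (hdom w hw).symm

theorem IsBiconnMax.not_separated (hG : G.IsBiconnMax) (hn : 4 < Fintype.card V) {x : V}
    {U W : Set V} (hcover : ∀ z, z = x ∨ z ∈ U ∨ z ∈ W) (hxU : x ∉ U) (hxW : x ∉ W)
    (hUW : ∀ z ∈ U, ∀ z' ∈ W, z ≠ z' ∧ ¬ G.Adj z z') (hU : U.Nonempty) (hW : W.Nonempty) :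
    False := by
  by_cases hdomW : ∀ z ∈ W, G.Adj x z
  · exact hG.not_dominated_part hn hcover hxU hxW hUW hW hdomW
  by_cases hdomU : ∀ z ∈ U, G.Adj x z
  · exact hG.not_dominated_part hn (fun z => (hcover z).imp id Or.symm) hxW hxU
      (fun z hz z' hz' => ⟨(hUW z' hz' z hz).1.symm, fun h => (hUW z' hz' z hz).2 h.symm⟩) hU hdomU
  -- Nonneighbours of `x` on both sides are at distance at least four.
  push Not at hdomW hdomU
  obtain ⟨w, hw, hxw⟩ := hdomW
  obtain ⟨u, hu, hxu⟩ := hdomU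
  have hstepU : ∀ {z}, G.Adj u z → z ∈ U := by
    intro z h
    rcases hcover z with rfl | h' | h'
    · exact absurd h.symm hxu
    · exact h'
    · exact absurd h (hUW u hu z h').2
  have hstepW : ∀ {z}, G.Adj z w → z ∈ W := by
    intro z h
    rcases hcover z with rfl | h' | h'
    · exact absurd h hxw
    · exact absurd h (hUW z h' w hw).2
    · exact h'
  rcases hG.exists_short_walk hn (hUW u hu w hw).1 with h | ⟨z, h, h'⟩ | ⟨z, z', h, h', h''⟩
  · exact (hUW u hu w hw).2 h
  · exact (hUW z (hstepU h) z (hstepW h')).1 rfl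
  · exact (hUW z (hstepU h) z' (hstepW h'')).2 h'

end

section

/-! ### Properties of maximisers -/

variable {V : Type*} [Fintype V] {G : SimpleGraph V}

theorem IsBiconnMax.connected_and_dist_le (hG : G.IsBiconnMax) (hn : 4 < Fintype.card V) :
    G.Connected ∧ ∀ u v, G.dist u v ≤ 3 := by
  have hwalk : ∀ u v, ∃ p : G.Walk u v, p.length ≤ 3 := by
    intro u v
    rcases eq_or_ne u v with rfl | huv
    · exact ⟨.nil, by simp⟩
    rcases hG.exists_short_walk hn huv with h | ⟨z, h, h'⟩ | ⟨z, z', h, h', h''⟩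
    · exact ⟨.cons h .nil, by simp⟩
    · exact ⟨.cons h (.cons h' .nil), by simp⟩
    · exact ⟨.cons h (.cons h' (.cons h'' .nil)), by simp⟩
  have : Nonempty V := Fintype.card_pos_iff.1 (by omega)
  exact ⟨⟨fun u v => (hwalk u v).elim fun p _ => ⟨p⟩⟩,
    fun u v => (hwalk u v).elim fun p hp => (dist_le p).trans hp⟩

theorem IsBiconnMax.diam_eq (hG : G.IsBiconnMax) (hn : 4 < Fintype.card V) :
    G.diam = 2 ∨ G.diam = 3 := by
  obtain ⟨hconn, hdist⟩ := hG.connected_and_dist_le hn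
  have : Nonempty V := Fintype.card_pos_iff.1 (by omega)
  have hle : G.diam ≤ 3 := by
    obtain ⟨u, v, huv⟩ := G.exists_dist_eq_diam
    exact huv ▸ hdist u v
  -- The complement has an edge, so `G` has two vertices at distance at least two.
  let v : V := Classical.arbitrary V
  obtain ⟨u, hvu⟩ := hG.compl.exists_adj hn v
  rw [compl_adj] at hvu
  have h0 : G.dist v u ≠ 0 := (hconn.pos_dist_of_ne hvu.1).ne'
  have h1 : G.dist v u ≠ 1 := fun h => hvu.2 (dist_eq_one_iff_adj.1 h)
  have := dist_le_diam (u := v) (v := u) (connected_iff_ediam_ne_top.1 hconn)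
  omega

theorem IsBiconnMax.not_isPendentVertex (hG : G.IsBiconnMax) (hn : 4 < Fintype.card V) (w : V) :
    ¬ G.IsPendentVertex w := by
  intro h
  obtain ⟨x, hx⟩ := Set.ncard_eq_one.1 h
  exact hG.not_pendent (x := x) (w := w) (fun z => by rw [← mem_neighborSet, hx]; rfl) hn

theorem IsBiconnMax.not_isCutVertex (hG : G.IsBiconnMax) (hn : 4 < Fintype.card V) (x : V) :
    ¬ G.IsCutVertex x := by
  intro h
  have hconn := (hG.connected_and_dist_le hn).1
  have : 1 < Nat.card (G.induce {x}ᶜ).ConnectedComponent :=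
    lt_of_le_of_lt (have := hconn.nonempty; Nat.card_pos) h
  have hnt := Finite.one_lt_card_iff_nontrivial.1 this
  obtain ⟨c, d, hcd⟩ := exists_pair_ne (G.induce {x}ᶜ).ConnectedComponent
  -- Separate the component `c` from the others.
  refine hG.not_separated hn (x := x)
    (U := {z | ∃ h : z ∈ ({x}ᶜ : Set V), (G.induce {x}ᶜ).connectedComponentMk ⟨z, h⟩ = c})
    (W := {z | ∃ h : z ∈ ({x}ᶜ : Set V), (G.induce {x}ᶜ).connectedComponentMk ⟨z, h⟩ ≠ c})
    (fun z => ?_) ?_ ?_ ?_ ?_ ?_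
  · by_cases hz : z = x
    · exact .inl hz
    · by_cases h : (G.induce {x}ᶜ).connectedComponentMk ⟨z, hz⟩ = c
      · exact .inr (.inl ⟨hz, h⟩)
      · exact .inr (.inr ⟨hz, h⟩)
  · rintro ⟨h, -⟩
    exact h rfl
  · rintro ⟨h, -⟩
    exact h rfl
  · rintro z ⟨hz, hzc⟩ z' ⟨hz', hzc'⟩
    refine ⟨?_, fun hadj => hzc' ?_⟩
    · rintro rfl
      exact hzc' hzc
    · rw [← hzc, eq_comm]
      exact ConnectedComponent.sound (Adj.reachable (by simpa using hadj))
  · obtain ⟨⟨z, hz⟩, rfl⟩ := c.exists_rep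
    exact ⟨z, hz, rfl⟩
  · obtain ⟨⟨z, hz⟩, rfl⟩ := d.exists_rep
    exact ⟨z, hz, hcd.symm⟩

end

end SimpleGraph

theorem theorem3p5 {V : Type*} [Fintype V] (hn : 4 < Fintype.card V) (G : SimpleGraph V)
    (hmax : ∀ H : SimpleGraph V,
      H.numConnectedInduced + Hᶜ.numConnectedInduced ≤
        G.numConnectedInduced + Gᶜ.numConnectedInduced) :
    (G.Connected ∧ Gᶜ.Connected) ∧
    ((G.diam = 2 ∨ G.diam = 3) ∧ (Gᶜ.diam = 2 ∨ Gᶜ.diam = 3)) ∧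
    (∀ v : V, (¬ G.IsPendentVertex v ∧ ¬ Gᶜ.IsPendentVertex v) ∧
      (¬ G.IsCutVertex v ∧ ¬ Gᶜ.IsCutVertex v)) := by
  have hG : G.IsBiconnMax := fun H => by
    have := hmax H
    rw [SimpleGraph.numConnectedInduced_add_compl, SimpleGraph.numConnectedInduced_add_compl] at this
    omega
  exact ⟨⟨(hG.connected_and_dist_le hn).1, (hG.compl.connected_and_dist_le hn).1⟩,
    ⟨hG.diam_eq hn, hG.compl.diam_eq hn⟩, fun v =>
      ⟨⟨hG.not_isPendentVertex hn v, hG.compl.not_isPendentVertex hn v⟩,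
        hG.not_isCutVertex hn v, hG.compl.not_isCutVertex hn v⟩⟩
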